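/- Let $A\in\mathbb R^{n\times n}$, $G\in\mathbb R^{n\times m}$ and $\bar c_1,\dots,\bar c_N\in\mathbb R^{n\times p}$, and consider the linear stochastic system $dx=Ax\,dt+G\,dw$ whose state is measured by $N$ sensors with outputs $y_i=\bar c_i^\top x+v_i$ (unit-covariance Gaussian noise). Put $\bar c:=[\bar c_1,\dots,\bar c_N]\in\mathbb R^{n\times Np}$. A period $\tau>0$ is divided into $r_{\rm tot}$ slots of equal length $\tau_0=\tau/r_{\rm tot}$. An allocation strategy is a vector $R=(R_1,\dots,R_{r_{\rm tot}})\in\{1,\dots,N\}^{r_{\rm tot}}$ in which every $i\in\{1,\dots,N\}$ occurs at least $r_{\min}$ times, where $r_{\min}\ge 1$ is a fixed integer; sensor $R_l$ is used in slot $l$, in every period. The error covariance of the optimal (Kalman) estimate is updated over one slot in which sensor $i$ is used by $$\phi_i(\Sigma):=\Big(\big(\Sigma^{-}\big)^{-1}+\bar c_i\bar c_i^\top\Big)^{-1},\qquad \Sigma^-:=e^{A\tau_0}\,\Sigma\, e^{A^\top\tau_0}+\int_0^{\tau_0}e^{As}GG^\top e^{A^\top s}\,ds,$$ and over one period by $\Phi_R:=\phi_{R_{r_{\rm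 tot}}}\circ\cdots\circ\phi_{R_1}$. Let $$\mathcal T:=\{\tau>0 \;:\; e^{\lambda\tau}\neq e^{\mu\tau}\ \text{for all distinct complex eigenvalues } \lambda\ne\mu \text{ of } A\}.$$ Suppose that $(A,\bar c)$ is observable, i.e. the matrix with the blocks $\bar c^\top,\bar c^\top A,\dots,\bar c^\top A^{n-1}$ stacked has rank $n$. Then, for every allocation strategy $R$ and every $\tau\in\mathcal T$, there is a matrix $\Sigma(\infty;\tau,R)$ such that $$\lim_{k\to\infty}\Phi_R^k(\Sigma(0))=\Sigma(\infty;\tau,R)$$ for every initial error covariance $\Sigma(0)$, that is, for every symmetric positive semidefinite $\Sigma(0)\in\mathbb R^{n\times n}$ for which the recursion is defined, meaning that $\Sigma(0)^-=e^{A\tau_0}\Sigma(0)e^{A^\top\tau_0}+\int_0^{\tau_0}e^{As}GG^\top e^{A^\top s}ds$ is invertible (then all later inverses exist as well). In particular the limit depends on $\tau$ and $R$ (and on the system), but not on $\Sigma(0)$. The condition on $\Sigma(0)$ holds for every positive definite $\Sigma(0)$, and for every positive semidefinite $\Sigma(0)$ if $(A,G)$ is controllable. -/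

import Mathlib

open Filter Topology

noncomputable section

namespace SampledEstimation

/-- The observability matrix of the pair `(A, c)`, for the output `y = cᵀ x`: the rows of
`cᵀ, cᵀ A, …, cᵀ A ^ (n - 1)` stacked on top of each other. -/
def observabilityMatrix {n : ℕ} {κ : Type*} (A : Matrix (Fin n) (Fin n) ℝ)
    (c : Matrix (Fin n) κ ℝ) : Matrix (Fin n × κ) (Fin n) ℝ :=
  Matrix.of fun kj i => (c.transpose * A ^ (kj.1 : ℕ)) kj.2 i

/-- The pair `(A, c)` is observable (output `y = cᵀ x`): its observability matrix has rank `n`. -/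
def IsObservable {n : ℕ} {κ : Type*} (A : Matrix (Fin n) (Fin n) ℝ)
    (c : Matrix (Fin n) κ ℝ) : Prop :=
  (observabilityMatrix A c).rank = n

/-- The block matrix `[c₁, …, c_N]`. -/
def concatSensors {n p N : ℕ} (c : Fin N → Matrix (Fin n) (Fin p) ℝ) :
    Matrix (Fin n) (Fin N × Fin p) ℝ :=
  Matrix.of fun a ij => c ij.1 a ij.2

/-- The set of periods `τ > 0` with `exp (λ τ) ≠ exp (μ τ)` for any two distinct complex
eigenvalues `λ, μ` of the real matrix `A`. -/
def nonAliasingPeriods {n : ℕ} (A : Matrix (Fin n) (Fin n) ℝ) : Set ℝ :=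
  {τ | 0 < τ ∧ ∀ z ∈ spectrum ℂ (A.map (algebraMap ℝ ℂ)),
    ∀ w ∈ spectrum ℂ (A.map (algebraMap ℝ ℂ)),
      z ≠ w → Complex.exp (z * (τ : ℂ)) ≠ Complex.exp (w * (τ : ℂ))}

/-- The strategy set: assignments of the `r` time slots of a period to the `N` sensors in which
each sensor receives at least `rmin` slots. -/
def strategySet (N r rmin : ℕ) : Set (Fin r → Fin N) :=
  {R | ∀ i, rmin ≤ (Finset.univ.filter fun l => R l = i).card}

/-- `∫₀ᵗ exp (s A) G Gᵀ exp (s Aᵀ) ds`, entry by entry. -/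
def noiseCov {n m : ℕ} (A : Matrix (Fin n) (Fin n) ℝ) (G : Matrix (Fin n) (Fin m) ℝ) (t : ℝ) :
    Matrix (Fin n) (Fin n) ℝ :=
  Matrix.of fun i j => ∫ s in (0 : ℝ)..t,
    (NormedSpace.exp (s • A) * (G * G.transpose) * NormedSpace.exp (s • A.transpose)) i j

/-- The error covariance just before a measurement, a time `t` after the covariance was `S`. -/
def predictCov {n m : ℕ} (A : Matrix (Fin n) (Fin n) ℝ) (G : Matrix (Fin n) (Fin m) ℝ) (t : ℝ)
    (S : Matrix (Fin n) (Fin n) ℝ) : Matrix (Fin n) (Fin n) ℝ :=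
  NormedSpace.exp (t • A) * S * NormedSpace.exp (t • A.transpose) + noiseCov A G t

/-- The covariance update over one time slot of length `t`, with a measurement by the sensor with
output matrix `cᵀ` at its end. -/
def slotUpdate {n m p : ℕ} (A : Matrix (Fin n) (Fin n) ℝ) (G : Matrix (Fin n) (Fin m) ℝ) (t : ℝ)
    (c : Matrix (Fin n) (Fin p) ℝ) (S : Matrix (Fin n) (Fin n) ℝ) : Matrix (Fin n) (Fin n) ℝ :=
  ((predictCov A G t S)⁻¹ + c * c.transpose)⁻¹

/-- The covariance update over one period `τ`, divided into `r` slots of length `τ / r`: the slot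
updates for the sensors `R 0, R 1, …, R (r - 1)`, applied in this order. -/
def periodUpdate {n m p N r : ℕ} (A : Matrix (Fin n) (Fin n) ℝ) (G : Matrix (Fin n) (Fin m) ℝ)
    (c : Fin N → Matrix (Fin n) (Fin p) ℝ) (τ : ℝ) (R : Fin r → Fin N)
    (S : Matrix (Fin n) (Fin n) ℝ) : Matrix (Fin n) (Fin n) ℝ :=
  (List.ofFn R).foldl (fun S' i => slotUpdate A G (τ / r) (c i) S') S

end SampledEstimation

end

/-! On positive definite matrices a slot update is a Riccati map, and every composition of slot
updates has the form `X ↦ Q + F (X⁻¹ + J)⁻¹ Fᵀ` (`HasInfoForm`), where `J` collects the information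
that the measurements give about the initial state. A vector in the kernel of `J` is invisible to
every measurement taken (`exists_hasInfoForm_foldl`). Over `n + 1` periods `J` is positive definite:
otherwise some nonzero state escapes each sensor at one fixed instant of every period. The
complexified space of such states is invariant under `exp (τ A)`, so it contains an eigenvector of
`exp (τ A)`. Since `τ` does not alias, this is an eigenvector of `A`, invisible to all sensors,
against observability (`eq_zero_of_sampled`).

Once `J` is positive definite, put `D = J⁻¹` and `Z = X + D`. The map becomes `T Z = W - B Z⁻¹ Bᵀ`,
which is monotone and concave, bounded above by `W`, and satisfies `D ≤ T D`. Its iterates from `W`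
decrease to a fixed point `Y ≥ D`, and they bound every trajectory from above. From below, a
trajectory starting strictly above `D` dominates `D + e (Y - D)` for some `e > 0`, and a
quantitative concavity estimate drives `e` to `1` geometrically (`exists_riccati_limit`). No
controllability of the noise is needed: `Y - D` may be singular, and only its kernel has to be
controlled. -/

namespace SampledEstimation

/-! ### Quadratic forms, the Loewner order and matrix limits -/

open Matrix

/-- The quadratic form `v ↦ vᵀ M v`. -/
def quad {n : ℕ} (M : Matrix (Fin n) (Fin n) ℝ) (v : Fin n → ℝ) : ℝ := v ⬝ᵥ M *ᵥ v

variable {n : ℕ} {A B D X Y : Matrix (Fin n) (Fin n) ℝ}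

lemma quad_add (A B : Matrix (Fin n) (Fin n) ℝ) (v : Fin n → ℝ) :
    quad (A + B) v = quad A v + quad B v := by
  simp [quad, add_mulVec, dotProduct_add]

lemma quad_sub (A B : Matrix (Fin n) (Fin n) ℝ) (v : Fin n → ℝ) :
    quad (A - B) v = quad A v - quad B v := by
  simp [quad, sub_mulVec, dotProduct_sub]

lemma quad_smul (a : ℝ) (A : Matrix (Fin n) (Fin n) ℝ) (v : Fin n → ℝ) :
    quad (a • A) v = a * quad A v := by
  simp [quad, smul_mulVec]

lemma quad_smul_vec (a : ℝ) (A : Matrix (Fin n) (Fin n) ℝ) (v : Fin n → ℝ) :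
    quad A (a • v) = a ^ 2 * quad A v := by
  simp [quad, mulVec_smul]; ring

lemma quad_conj (B A : Matrix (Fin n) (Fin n) ℝ) (v : Fin n → ℝ) :
    quad (B * A * Bᵀ) v = quad A (Bᵀ *ᵥ v) := by
  simp [quad, ← mulVec_mulVec, dotProduct_mulVec, mulVec_transpose]

lemma dotProduct_mulVec_symm (hA : A.IsHermitian) (v w : Fin n → ℝ) :
    v ⬝ᵥ A *ᵥ w = w ⬝ᵥ A *ᵥ v := by
  have h : Aᵀ = A := by simpa using hA.eq
  rw [dotProduct_mulVec, ← mulVec_transpose, h, dotProduct_comm]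

lemma posSemidef_iff_quad : A.PosSemidef ↔ A.IsHermitian ∧ ∀ v, 0 ≤ quad A v := by
  simp [posSemidef_iff_dotProduct_mulVec, quad]

lemma posDef_iff_quad : A.PosDef ↔ A.IsHermitian ∧ ∀ v, v ≠ 0 → 0 < quad A v := by
  simp [posDef_iff_dotProduct_mulVec, quad]

lemma quad_nonneg (hA : A.PosSemidef) (v : Fin n → ℝ) : 0 ≤ quad A v :=
  (posSemidef_iff_quad.1 hA).2 v

lemma quad_eq_zero_iff (hA : A.PosSemidef) (v : Fin n → ℝ) : quad A v = 0 ↔ A *ᵥ v = 0 := by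
  simpa [quad] using hA.dotProduct_mulVec_zero_iff v

lemma mulVec_inv_mulVec (hA : IsUnit A) (v : Fin n → ℝ) : A *ᵥ (A⁻¹ *ᵥ v) = v := by
  rw [mulVec_mulVec, mul_nonsing_inv _ ((isUnit_iff_isUnit_det _).1 hA), one_mulVec]

lemma inv_mulVec_mulVec (hA : IsUnit A) (v : Fin n → ℝ) : A⁻¹ *ᵥ (A *ᵥ v) = v := by
  rw [mulVec_mulVec, nonsing_inv_mul _ ((isUnit_iff_isUnit_det _).1 hA), one_mulVec]

lemma quad_sub_vec (hA : A.IsHermitian) (v w : Fin n → ℝ) :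
    quad A (v - w) = quad A v - 2 * (v ⬝ᵥ A *ᵥ w) + quad A w := by
  simp only [quad, mulVec_sub, dotProduct_sub, sub_dotProduct, dotProduct_mulVec_symm hA w v]
  ring

lemma quad_add_vec (hA : A.IsHermitian) (v w : Fin n → ℝ) :
    quad A (v + w) = quad A v + 2 * (v ⬝ᵥ A *ᵥ w) + quad A w := by
  simp only [quad, mulVec_add, dotProduct_add, add_dotProduct, dotProduct_mulVec_symm hA w v]
  ring

/-- Completing the square. -/
lemma two_mul_dotProduct_sub_quad (hX : X.PosDef) (v x : Fin n → ℝ) :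
    2 * (x ⬝ᵥ v) - quad X x = quad X⁻¹ v - quad X (x - X⁻¹ *ᵥ v) := by
  rw [quad_sub_vec hX.1, mulVec_inv_mulVec hX.isUnit]
  have : quad X (X⁻¹ *ᵥ v) = quad X⁻¹ v := by
    rw [quad, mulVec_inv_mulVec hX.isUnit, dotProduct_comm, quad]
  rw [this]; ring

lemma quad_inv_eq (hX : X.PosDef) (v : Fin n → ℝ) :
    quad X⁻¹ v = 2 * (X⁻¹ *ᵥ v ⬝ᵥ v) - quad X (X⁻¹ *ᵥ v) := by
  rw [two_mul_dotProduct_sub_quad hX]; simp [quad]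

/-- By completing the square, `quad X⁻¹ v` is the maximum over `x` of `2 (x ⬝ᵥ v) - quad X x`, which
decreases as `X` grows. -/
lemma quad_inv_anti (hX : X.PosDef) (hY : Y.PosDef) (h : ∀ v, quad X v ≤ quad Y v)
    (v : Fin n → ℝ) : quad Y⁻¹ v ≤ quad X⁻¹ v := by
  rw [quad_inv_eq hY]
  have h1 := two_mul_dotProduct_sub_quad hX v (Y⁻¹ *ᵥ v)
  have h2 := quad_nonneg hX.posSemidef (Y⁻¹ *ᵥ v - X⁻¹ *ᵥ v)
  linarith [h (Y⁻¹ *ᵥ v)]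

lemma posDef_convex (hX : X.PosDef) (hY : Y.PosDef) {e : ℝ} (h0 : 0 ≤ e) (h1 : e ≤ 1) :
    ((1 - e) • X + e • Y).PosDef := by
  rcases h0.eq_or_lt with rfl | h0
  · simpa using hX
  · exact PosDef.posSemidef_add (hX.posSemidef.smul (by linarith)) (hY.smul h0)

/-- A quantitative form of the convexity of matrix inversion. -/
lemma quad_inv_convex (hD : D.PosDef) (hY : Y.PosDef) (hDY : ∀ v, quad D v ≤ quad Y v)
    {e : ℝ} (h0 : 0 ≤ e) (h1 : e ≤ 1) (v : Fin n → ℝ) :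
    quad ((1 - e) • D + e • Y)⁻¹ v + e * (1 - e) * quad D ((D⁻¹ - Y⁻¹) *ᵥ v) ≤
      (1 - e) * quad D⁻¹ v + e * quad Y⁻¹ v := by
  rw [quad_inv_eq (posDef_convex hD hY h0 h1)]
  set x := ((1 - e) • D + e • Y)⁻¹ *ᵥ v
  have hd := two_mul_dotProduct_sub_quad hD v x
  have hy := two_mul_dotProduct_sub_quad hY v x
  rw [quad_add, quad_smul, quad_smul]
  set p := x - D⁻¹ *ᵥ v
  set q := x - Y⁻¹ *ᵥ v
  have hpq : (D⁻¹ - Y⁻¹) *ᵥ v = q - p := by simp [p, q, sub_mulVec]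
  have h2 := hDY q
  -- This term is exactly `(1 - e) quad D p + e quad D q - e (1 - e) quad D (q - p)`.
  have h3 := quad_nonneg hD.posSemidef ((1 - e) • p + e • q)
  rw [quad_add_vec hD.1, quad_smul_vec, quad_smul_vec, mulVec_smul, smul_dotProduct,
    dotProduct_smul, smul_eq_mul, smul_eq_mul] at h3
  rw [hpq, quad_sub_vec hD.1, dotProduct_mulVec_symm hD.1 q p]
  have h4 : e * quad D q ≤ e * quad Y q := mul_le_mul_of_nonneg_left h2 h0
  have e1 : 2 * (x ⬝ᵥ v) = (1 - e) * (quad D⁻¹ v - quad D p + quad D x)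
      + e * (quad Y⁻¹ v - quad Y q + quad Y x) := by
    rw [← sub_eq_iff_eq_add.1 hd, ← sub_eq_iff_eq_add.1 hy]; ring
  rw [e1]
  nlinarith [h3, h4]

lemma continuous_quad (A : Matrix (Fin n) (Fin n) ℝ) : Continuous (quad A) := by
  unfold quad; fun_prop

lemma quad_add_ker (hA : A.IsHermitian) {k : Fin n → ℝ} (hk : A *ᵥ k = 0) (v : Fin n → ℝ) :
    quad A (v + k) = quad A v := by
  rw [quad_add_vec hA, quad, quad, hk]; simp

/-- A positive semidefinite form dominates, up to a factor, each one with a larger kernel. -/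
lemma exists_pos_mul_quad_le (hA : A.PosSemidef) (hX : X.PosSemidef)
    (h : ∀ v, A *ᵥ v = 0 → X *ᵥ v = 0) : ∃ δ > 0, ∀ v, δ * quad X v ≤ quad A v := by
  obtain ⟨C, hC⟩ := Submodule.exists_isCompl (LinearMap.ker A.mulVecLin)
  set S : Set (Fin n → ℝ) := Metric.sphere 0 1 ∩ C
  have hS : IsCompact S := (isCompact_sphere 0 1).inter_right C.closed_of_finiteDimensional
  obtain ⟨m, hm, hmS⟩ : ∃ m > 0, ∀ v ∈ S, m ≤ quad A v := by
    rcases S.eq_empty_or_nonempty with hE | hN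
    · exact ⟨1, one_pos, by simp [hE]⟩
    · obtain ⟨x, hx, hmin⟩ := hS.exists_isMinOn hN (continuous_quad A).continuousOn
      refine ⟨quad A x, lt_of_le_of_ne (quad_nonneg hA x) fun h0 => ?_, fun v hv => hmin hv⟩
      have hk : x ∈ LinearMap.ker A.mulVecLin := by
        simpa using (quad_eq_zero_iff hA x).1 h0.symm
      have : x = 0 := by simpa using (Submodule.disjoint_def.1 hC.disjoint) x hk hx.2
      have h1 := hx.1
      simp [this] at h1
  obtain ⟨M, hM⟩ := hS.bddAbove_image (continuous_quad X).continuousOn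
  have hMS : ∀ v ∈ S, quad X v ≤ |M| + 1 := fun v hv => by
    linarith [hM (Set.mem_image_of_mem _ hv), le_abs_self M]
  have hM0 : 0 < |M| + 1 := by positivity
  refine ⟨m / (|M| + 1), div_pos hm hM0, fun v => ?_⟩
  obtain ⟨k, w, hk, hw, rfl⟩ := Submodule.codisjoint_iff_exists_add_eq.1 hC.codisjoint v
  have hk' : A *ᵥ k = 0 := by simpa using hk
  rw [add_comm k w, quad_add_ker hX.1 (h k hk'), quad_add_ker hA.1 hk']
  rcases eq_or_ne w 0 with rfl | hw0
  · simp [quad]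
  · have hn : 0 < ‖w‖ := norm_pos_iff.2 hw0
    have hu : ‖w‖⁻¹ • w ∈ S := ⟨by simp [norm_smul, hn.ne'], C.smul_mem _ hw⟩
    have h1 := hmS _ hu
    have h2 := hMS _ hu
    rw [quad_smul_vec] at h1 h2
    have hp : 0 < ‖w‖⁻¹ ^ 2 := by positivity
    rw [div_mul_eq_mul_div, div_le_iff₀ hM0]
    have h3 : m * (‖w‖⁻¹ ^ 2 * quad X w) ≤ ‖w‖⁻¹ ^ 2 * quad A w * (|M| + 1) :=
      mul_le_mul h1 h2 (mul_nonneg hp.le (quad_nonneg hX w)) (hm.le.trans h1)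
    refine le_of_mul_le_mul_left ?_ hp
    linarith

lemma entry_eq_quad (hA : A.IsHermitian) (i j : Fin n) :
    A i j = (quad A (Pi.single i 1 + Pi.single j 1) - quad A (Pi.single i 1)
      - quad A (Pi.single j 1)) / 2 := by
  rw [quad_add_vec hA]
  simp
  ring

lemma tendsto_of_quad {f : ℕ → Matrix (Fin n) (Fin n) ℝ} (hf : ∀ k, (f k).IsHermitian)
    (hA : A.IsHermitian) (h : ∀ v, Tendsto (fun k => quad (f k) v) atTop (𝓝 (quad A v))) :
    Tendsto f atTop (𝓝 A) := by
  refine tendsto_pi_nhds.2 fun i => tendsto_pi_nhds.2 fun j => ?_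
  simp_rw [entry_eq_quad (hf _), entry_eq_quad hA i j]
  exact (((h _).sub (h _)).sub (h _)).div_const _

lemma tendsto_quad {f : ℕ → Matrix (Fin n) (Fin n) ℝ} (h : Tendsto f atTop (𝓝 A))
    (v : Fin n → ℝ) : Tendsto (fun k => quad (f k) v) atTop (𝓝 (quad A v)) := by
  have : Continuous fun M : Matrix (Fin n) (Fin n) ℝ => quad M v := by unfold quad; fun_prop
  exact (this.tendsto A).comp h

/-- Each value of the quadratic form converges by monotonicity, and the entries follow by
polarization. -/
lemma exists_tendsto_of_antitone {f : ℕ → Matrix (Fin n) (Fin n) ℝ}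
    (hf : ∀ k, (f k).IsHermitian) (ha : ∀ k v, quad (f (k + 1)) v ≤ quad (f k) v)
    (hb : ∀ k v, quad D v ≤ quad (f k) v) :
    ∃ A : Matrix (Fin n) (Fin n) ℝ, A.IsHermitian ∧ Tendsto f atTop (𝓝 A) := by
  have hq : ∀ v, ∃ a, Tendsto (fun k => quad (f k) v) atTop (𝓝 a) := fun v =>
    ⟨_, tendsto_atTop_ciInf (antitone_nat_of_succ_le fun k => ha k v)
      ⟨quad D v, by rintro _ ⟨k, rfl⟩; exact hb k v⟩⟩
  have he : ∀ i j, ∃ a, Tendsto (fun k => f k i j) atTop (𝓝 a) := fun i j => by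
    simp_rw [entry_eq_quad (hf _)]
    obtain ⟨a, ha⟩ := hq (Pi.single i 1 + Pi.single j 1)
    obtain ⟨b, hb⟩ := hq (Pi.single i 1)
    obtain ⟨c, hc⟩ := hq (Pi.single j 1)
    exact ⟨_, ((ha.sub hb).sub hc).div_const _⟩
  choose a ha using he
  refine ⟨Matrix.of a, ?_, tendsto_pi_nhds.2 fun i => tendsto_pi_nhds.2 fun j => ha i j⟩
  ext i j
  refine tendsto_nhds_unique (ha j i) ((ha i j).congr fun k => ?_)
  simpa using ((hf k).apply i j).symm

lemma tendsto_matrix_inv {f : ℕ → Matrix (Fin n) (Fin n) ℝ} (hA : IsUnit A)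
    (h : Tendsto f atTop (𝓝 A)) : Tendsto (fun k => (f k)⁻¹) atTop (𝓝 A⁻¹) := by
  simp_rw [Matrix.inv_def, Ring.inverse_eq_inv']
  have hd : Continuous fun M : Matrix (Fin n) (Fin n) ℝ => M.det := by fun_prop
  have had : Continuous fun M : Matrix (Fin n) (Fin n) ℝ => M.adjugate := by fun_prop
  exact (((hd.tendsto A).comp h).inv₀ ((isUnit_iff_isUnit_det _).1 hA).ne_zero).smul
    ((had.tendsto A).comp h)

end SampledEstimation

namespace SampledEstimation

/-! ### Convergence of Riccati iterations -/

open Matrix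

variable {n : ℕ} {A B D W X Y : Matrix (Fin n) (Fin n) ℝ}

lemma posDef_of_quad_le (hD : D.PosDef) (hX : X.IsHermitian) (h : ∀ v, quad D v ≤ quad X v) :
    X.PosDef :=
  posDef_iff_quad.2 ⟨hX, fun v hv => ((posDef_iff_quad.1 hD).2 v hv).trans_le (h v)⟩

lemma isHermitian_conj (B : Matrix (Fin n) (Fin n) ℝ) (hA : A.IsHermitian) :
    (B * A * Bᵀ).IsHermitian := by
  simpa using isHermitian_mul_mul_conjTranspose B hA

/-- Iterates of a Riccati map `Y ↦ W - B Y⁻¹ Bᵀ` for which `D` is a subsolution decrease to a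
fixed point when started at `W`. -/
lemma exists_riccati_fixedPoint (hD : D.PosDef) (hW : W.IsHermitian)
    (hQ : ∀ v, quad D v + quad D⁻¹ (Bᵀ *ᵥ v) ≤ quad W v) :
    ∃ Y : Matrix (Fin n) (Fin n) ℝ, Y.IsHermitian ∧ (∀ v, quad D v ≤ quad Y v) ∧
      Y = W - B * Y⁻¹ * Bᵀ ∧
      Tendsto (fun k => (fun Z => W - B * Z⁻¹ * Bᵀ)^[k] W) atTop (𝓝 Y) := by
  set T : Matrix (Fin n) (Fin n) ℝ → Matrix (Fin n) (Fin n) ℝ := fun Z => W - B * Z⁻¹ * Bᵀ with hT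
  have hT1 : ∀ Z, Z.IsHermitian → (T Z).IsHermitian := fun Z hZ =>
    hW.sub (isHermitian_conj B hZ.inv)
  have hTq : ∀ Z v, quad (T Z) v = quad W v - quad Z⁻¹ (Bᵀ *ᵥ v) := fun Z v => by
    rw [hT, quad_sub, quad_conj]
  have hU : ∀ k, (T^[k] W).IsHermitian ∧ ∀ v, quad D v ≤ quad (T^[k] W) v := by
    intro k
    induction k with
    | zero =>
      refine ⟨hW, fun v => ?_⟩
      have := quad_nonneg hD.inv.posSemidef (Bᵀ *ᵥ v)
      have := hQ v
      simp only [Function.iterate_zero, id]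
      linarith
    | succ k ih =>
      rw [Function.iterate_succ_apply']
      refine ⟨hT1 _ ih.1, fun v => ?_⟩
      have h1 := quad_inv_anti hD (posDef_of_quad_le hD ih.1 ih.2) ih.2 (Bᵀ *ᵥ v)
      have := hQ v
      rw [hTq]
      linarith
  have hP : ∀ k, (T^[k] W).PosDef := fun k => posDef_of_quad_le hD (hU k).1 (hU k).2
  have ha : ∀ k v, quad (T^[k + 1] W) v ≤ quad (T^[k] W) v := by
    intro k
    induction k with
    | zero =>
      intro v
      have := quad_nonneg (hP 0).inv.posSemidef (Bᵀ *ᵥ v)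
      rw [Function.iterate_succ_apply', hTq]
      simpa using this
    | succ k ih =>
      intro v
      rw [Function.iterate_succ_apply' T (k + 1), Function.iterate_succ_apply' T k, hTq, hTq,
        ← Function.iterate_succ_apply' T k]
      linarith [quad_inv_anti (hP (k + 1)) (hP k) ih (Bᵀ *ᵥ v)]
  obtain ⟨Y, hY, hlim⟩ := exists_tendsto_of_antitone (fun k => (hU k).1) ha (fun k => (hU k).2)
  have hDY : ∀ v, quad D v ≤ quad Y v := fun v =>
    ge_of_tendsto' (tendsto_quad hlim v) fun k => (hU k).2 v
  refine ⟨Y, hY, hDY, ?_, hlim⟩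
  have hYP := posDef_of_quad_le hD hY hDY
  have h1 : Tendsto (fun k => T^[k + 1] W) atTop (𝓝 (W - B * Y⁻¹ * Bᵀ)) := by
    simp_rw [Function.iterate_succ_apply']
    have hc : Continuous fun M : Matrix (Fin n) (Fin n) ℝ => W - B * M * Bᵀ := by fun_prop
    exact (hc.tendsto _).comp (tendsto_matrix_inv hYP.isUnit hlim)
  exact tendsto_nhds_unique ((tendsto_add_atTop_iff_nat 1).2 hlim) h1

lemma inv_sub_inv_eq (hD : IsUnit D) (hY : IsUnit Y) : D⁻¹ - Y⁻¹ = D⁻¹ * (Y - D) * Y⁻¹ := by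
  rw [isUnit_iff_isUnit_det] at hD hY
  rw [mul_sub, sub_mul, nonsing_inv_mul _ hD, mul_assoc, mul_nonsing_inv _ hY]
  simp

lemma mulVec_eq_zero_of_rank_le {A X : Matrix (Fin n) (Fin n) ℝ} (hr : X.rank ≤ A.rank)
    (h : ∀ v, X *ᵥ v = 0 → A *ᵥ v = 0) (v : Fin n → ℝ) (hv : A *ᵥ v = 0) : X *ᵥ v = 0 := by
  have hle : LinearMap.ker X.mulVecLin ≤ LinearMap.ker A.mulVecLin := fun w hw => by
    simpa using h w (by simpa using hw)
  have e1 := LinearMap.finrank_range_add_finrank_ker X.mulVecLin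
  have e2 := LinearMap.finrank_range_add_finrank_ker A.mulVecLin
  have : LinearMap.ker X.mulVecLin = LinearMap.ker A.mulVecLin := by
    refine Submodule.eq_of_le_of_finrank_le hle ?_
    unfold Matrix.rank at hr
    omega
  have hv' : v ∈ LinearMap.ker X.mulVecLin := by rw [this]; simpa using hv
  simpa using hv'

/-- The strict concavity of the Riccati map between a subsolution and a fixed point. -/
lemma exists_riccati_gap (hD : D.PosDef) (hB : IsUnit B) (hY : Y.IsHermitian)
    (hQ : ∀ v, quad D v + quad D⁻¹ (Bᵀ *ᵥ v) ≤ quad W v) (hDY : ∀ v, quad D v ≤ quad Y v)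
    (hfix : Y = W - B * Y⁻¹ * Bᵀ) :
    ∃ κ > 0, κ ≤ 1 ∧ ∀ v, κ * quad (Y - D) v ≤ quad D ((D⁻¹ - Y⁻¹) *ᵥ (Bᵀ *ᵥ v)) := by
  have hYP := posDef_of_quad_le hD hY hDY
  have hX : (Y - D).PosSemidef := posSemidef_iff_quad.2
    ⟨hY.sub hD.1, fun v => by rw [quad_sub]; linarith [hDY v]⟩
  set K := D⁻¹ - Y⁻¹ with hK
  have hKH : K.IsHermitian := hD.1.inv.sub hY.inv
  have hKP : K.PosSemidef := posSemidef_iff_quad.2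
    ⟨hKH, fun v => by rw [quad_sub]; linarith [quad_inv_anti hD hYP hDY v]⟩
  -- Subtract the subsolution inequality for `D` from the fixed point equation for `Y`.
  have hKX : ∀ v, quad K (Bᵀ *ᵥ v) ≤ quad (Y - D) v := fun v => by
    have h1 := congrArg (fun M => quad M v) hfix
    simp only [quad_sub, quad_conj] at h1
    rw [hK, quad_sub, quad_sub]
    linarith [hQ v]
  have hG : (B * (K * D * Kᵀ) * Bᵀ).PosSemidef := by
    have := (hD.posSemidef.mul_mul_conjTranspose_same K).mul_mul_conjTranspose_same B
    simpa using this
  have hGq : ∀ v, quad (B * (K * D * Kᵀ) * Bᵀ) v = quad D (K *ᵥ (Bᵀ *ᵥ v)) := fun v => by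
    rw [quad_conj, quad_conj, show Kᵀ = K by simpa using hKH.eq]
  have hBT : IsUnit Bᵀ.det := by rw [det_transpose]; exact (isUnit_iff_isUnit_det _).1 hB
  -- `K = D⁻¹ (Y - D) Y⁻¹`, so the ranks agree. With `hKX`, which puts the kernel of `Y - D` inside
  -- that of `K * Bᵀ`, the two kernels coincide.
  have hrank : (Y - D).rank ≤ (K * Bᵀ).rank := by
    rw [rank_mul_eq_left_of_isUnit_det _ _ hBT, hK, inv_sub_inv_eq hD.isUnit hYP.isUnit,
      rank_mul_eq_left_of_isUnit_det _ _ ((isUnit_iff_isUnit_det _).1 hYP.inv.isUnit),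
      rank_mul_eq_right_of_isUnit_det _ _ ((isUnit_iff_isUnit_det _).1 hD.inv.isUnit)]
  obtain ⟨δ, hδ, h⟩ := exists_pos_mul_quad_le hG hX fun v hv => by
    refine mulVec_eq_zero_of_rank_le hrank (fun w hw => ?_) v ?_
    · rw [← mulVec_mulVec]
      refine (quad_eq_zero_iff hKP _).1 (le_antisymm ?_ (quad_nonneg hKP _))
      exact (hKX w).trans_eq ((quad_eq_zero_iff hX w).2 hw)
    · have h0 := (quad_eq_zero_iff hG v).2 hv
      rw [hGq] at h0
      by_contra hne
      rw [← mulVec_mulVec] at hne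
      exact ((posDef_iff_quad.1 hD).2 _ hne).ne' h0
  refine ⟨min δ 1, lt_min hδ one_pos, min_le_right _ _, fun v => ?_⟩
  rw [← hGq]
  exact (mul_le_mul_of_nonneg_right (min_le_left _ _) (quad_nonneg hX v)).trans (h v)

/-- Every trajectory of a Riccati map that starts strictly above a subsolution tends to the same
limit. -/
theorem exists_riccati_limit (hD : D.PosDef) (hB : IsUnit B) (hW : W.IsHermitian)
    (hQ : ∀ v, quad D v + quad D⁻¹ (Bᵀ *ᵥ v) ≤ quad W v) :
    ∃ Y : Matrix (Fin n) (Fin n) ℝ, ∀ f : ℕ → Matrix (Fin n) (Fin n) ℝ, (f 0 - D).PosDef →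
      (∀ k, f (k + 1) = W - B * (f k)⁻¹ * Bᵀ) → Tendsto f atTop (𝓝 Y) := by
  obtain ⟨Y, hY, hDY, hfix, hlim⟩ := exists_riccati_fixedPoint hD hW hQ
  obtain ⟨κ, hκ, hκ1, hgap⟩ := exists_riccati_gap hD hB hY hQ hDY hfix
  have hYP := posDef_of_quad_le hD hY hDY
  have hX : (Y - D).PosSemidef := posSemidef_iff_quad.2
    ⟨hY.sub hD.1, fun v => by rw [quad_sub]; linarith [hDY v]⟩
  refine ⟨Y, fun f hf0 hf => ?_⟩
  obtain ⟨δ, hδ, hδX⟩ := exists_pos_mul_quad_le hf0.posSemidef hX fun v hv => by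
    have := inv_mulVec_mulVec hf0.isUnit v
    rw [hv, mulVec_zero] at this
    rw [← this, mulVec_zero]
  set e₀ := min δ 1
  have he0 : 0 < e₀ := lt_min hδ one_pos
  have he1 : e₀ ≤ 1 := min_le_right _ _
  have hρ0 : 0 ≤ 1 - κ * e₀ := by nlinarith
  have hρ1 : 1 - κ * e₀ < 1 := by nlinarith [mul_pos hκ he0]
  have hfq : ∀ k v, quad (f (k + 1)) v = quad W v - quad (f k)⁻¹ (Bᵀ *ᵥ v) := fun k v => by
    rw [hf, quad_sub, quad_conj]
  have hfH : ∀ k, (f k).IsHermitian := by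
    intro k
    induction k with
    | zero => simpa using hf0.1.add hD.1
    | succ k ih => rw [hf]; exact hW.sub (isHermitian_conj B ih.inv)
  have hlow : ∀ k, ∃ e, e₀ ≤ e ∧ e ≤ 1 ∧ 1 - e ≤ (1 - κ * e₀) ^ k ∧
      ∀ v, quad D v + e * quad (Y - D) v ≤ quad (f k) v := by
    intro k
    induction k with
    | zero =>
      refine ⟨e₀, le_rfl, he1, by simpa using he0.le, fun v => ?_⟩
      have h1 := hδX v
      have h2 := mul_le_mul_of_nonneg_right (min_le_left δ 1) (quad_nonneg hX v)
      rw [quad_sub (f 0)] at h1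
      linarith
    | succ k ih =>
      obtain ⟨e, h0, h1, h2, h3⟩ := ih
      -- By concavity `T ((1 - e) D + e Y)` is at least `(1 - e) T D + e T Y` plus `e (1 - e)` times
      -- the gap. As `T D ≥ D`, `T Y = Y` and the gap is at least `κ (Y - D)`, the weight gains `κ e
      -- (1 - e)`. So `1 - e` is multiplied by `1 - κ e ≤ 1 - κ e₀`.
      refine ⟨e + κ * e * (1 - e), ?_, ?_, ?_, fun v => ?_⟩
      · have : 0 ≤ κ * e * (1 - e) :=
          mul_nonneg (mul_nonneg hκ.le (he0.le.trans h0)) (by linarith)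
        linarith
      · have : κ * e ≤ 1 := by nlinarith
        nlinarith
      · rw [pow_succ]
        have e1 : 1 - (e + κ * e * (1 - e)) = (1 - e) * (1 - κ * e) := by ring
        rw [e1]
        exact mul_le_mul h2 (by nlinarith) (by nlinarith) (by positivity)
      · have he : 0 ≤ e := he0.le.trans h0
        have hZ := posDef_convex hD hYP he h1
        have hZq : ∀ v, quad ((1 - e) • D + e • Y) v = quad D v + e * quad (Y - D) v := fun v => by
          rw [quad_add, quad_smul, quad_smul, quad_sub]; ring
        have hZf : ∀ v, quad ((1 - e) • D + e • Y) v ≤ quad (f k) v := fun v => by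
          rw [hZq]; exact h3 v
        have a1 := quad_inv_anti hZ (posDef_of_quad_le hZ (hfH k) hZf) hZf (Bᵀ *ᵥ v)
        have a2 := quad_inv_convex hD hYP hDY he h1 (Bᵀ *ᵥ v)
        have a3 := mul_le_mul_of_nonneg_left (hgap v) (mul_nonneg he (sub_nonneg.2 h1))
        have a4 := mul_le_mul_of_nonneg_left (hQ v) (sub_nonneg.2 h1)
        have a5 : quad Y v = quad W v - quad Y⁻¹ (Bᵀ *ᵥ v) := by
          have := congrArg (fun M => quad M v) hfix
          simpa only [quad_sub, quad_conj] using this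
        rw [hfq]
        have a6 : quad (Y - D) v = quad Y v - quad D v := quad_sub _ _ _
        have a7 : e * quad Y v = e * (quad W v - quad Y⁻¹ (Bᵀ *ᵥ v)) := by rw [a5]
        have a8 : e * quad (Y - D) v = e * quad Y v - e * quad D v := by rw [a6]; ring
        linarith
  have hfP : ∀ k, (f k).PosDef := fun k => by
    obtain ⟨e, h0, -, -, h3⟩ := hlow k
    refine posDef_of_quad_le hD (hfH k) fun v => ?_
    have := mul_nonneg (he0.le.trans h0) (quad_nonneg hX v)
    linarith [h3 v]
  -- One step brings any trajectory below `W`; afterwards monotonicity compares it with the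
  -- trajectory of `W`.
  have hup : ∀ k v, quad (f (k + 1)) v ≤ quad ((fun Z => W - B * Z⁻¹ * Bᵀ)^[k] W) v := by
    intro k
    induction k with
    | zero =>
      intro v
      rw [hfq]
      simpa using quad_nonneg (hfP 0).inv.posSemidef (Bᵀ *ᵥ v)
    | succ k ih =>
      intro v
      rw [hfq, Function.iterate_succ_apply', quad_sub, quad_conj]
      have hUH : ((fun Z => W - B * Z⁻¹ * Bᵀ)^[k] W).IsHermitian := by
        clear ih
        induction k with
        | zero => exact hW
        | succ k ih =>
          rw [Function.iterate_succ_apply']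
          exact hW.sub (isHermitian_conj B ih.inv)
      linarith [quad_inv_anti (hfP (k + 1)) (posDef_of_quad_le (hfP (k + 1)) hUH ih) ih (Bᵀ *ᵥ v)]
  rw [← tendsto_add_atTop_iff_nat 1]
  refine tendsto_of_quad (fun k => hfH (k + 1)) hY fun v => ?_
  have hl : Tendsto (fun k : ℕ => quad Y v - (1 - κ * e₀) ^ (k + 1) * quad (Y - D) v) atTop
      (𝓝 (quad Y v)) := by
    have h1 := (((tendsto_pow_atTop_nhds_zero_of_lt_one hρ0 hρ1).comp
      (tendsto_add_atTop_nat 1)).mul_const (quad (Y - D) v)).const_sub (quad Y v)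
    simpa using h1
  refine tendsto_of_tendsto_of_tendsto_of_le_of_le hl (tendsto_quad hlim v) (fun k => ?_)
    fun k => hup k v
  obtain ⟨e, -, -, h2, h3⟩ := hlow (k + 1)
  have h4 := mul_le_mul_of_nonneg_right h2 (quad_nonneg hX v)
  have h5 : quad (Y - D) v = quad Y v - quad D v := quad_sub _ _ _
  have h6 := h3 v
  simp only
  linarith

end SampledEstimation

namespace SampledEstimation

/-! ### The information form of the covariance updates -/

open Matrix

variable {n m p N : ℕ} {A C F J Q W X : Matrix (Fin n) (Fin n) ℝ}

lemma posDef_conj (hF : IsUnit F) (hX : X.PosDef) : (F * X * Fᵀ).PosDef := by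
  simpa [star_eq_conjTranspose] using (IsUnit.posDef_star_right_conjugate_iff hF).2 hX

lemma posSemidef_conj (F : Matrix (Fin n) (Fin n) ℝ) (hX : X.PosSemidef) :
    (F * X * Fᵀ).PosSemidef := by
  simpa using hX.mul_mul_conjTranspose_same F

/-- The map `f` has the form `X ↦ Q + F (X⁻¹ + J)⁻¹ Fᵀ` on positive definite matrices, with
positive semidefinite `Q`, `J` and invertible `F`. -/
structure HasInfoForm (f : Matrix (Fin n) (Fin n) ℝ → Matrix (Fin n) (Fin n) ℝ)
    (Q J F : Matrix (Fin n) (Fin n) ℝ) : Prop where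
  posQ : Q.PosSemidef
  posJ : J.PosSemidef
  unitF : IsUnit F
  eq : ∀ X, X.PosDef → f X = Q + F * (X⁻¹ + J)⁻¹ * Fᵀ

lemma HasInfoForm.posDef {f : Matrix (Fin n) (Fin n) ℝ → Matrix (Fin n) (Fin n) ℝ}
    (h : HasInfoForm f Q J F) (hX : X.PosDef) : (f X).PosDef := by
  rw [h.eq X hX]
  exact PosDef.posSemidef_add h.posQ (posDef_conj h.unitF (hX.inv.add_posSemidef h.posJ).inv)

/-- The Woodbury identity. It turns the information form into a Riccati map in the shifted variable
`X + J⁻¹`. -/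
lemma inv_add_inv_eq (hJ : J.PosDef) (hX : X.PosDef) :
    (X⁻¹ + J)⁻¹ = J⁻¹ - J⁻¹ * (X + J⁻¹)⁻¹ * J⁻¹ := by
  have hX' := (isUnit_iff_isUnit_det _).1 hX.isUnit
  have hJ' := (isUnit_iff_isUnit_det _).1 hJ.isUnit
  have hS := (isUnit_iff_isUnit_det _).1 (hX.add hJ.inv).isUnit
  refine inv_eq_right_inv ?_
  have h1 : (X⁻¹ + J) * J⁻¹ = X⁻¹ * (X + J⁻¹) := by
    rw [add_mul, mul_add, mul_nonsing_inv _ hJ', nonsing_inv_mul _ hX', add_comm]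
  rw [mul_sub, ← mul_assoc, ← mul_assoc, h1, mul_assoc X⁻¹, mul_nonsing_inv _ hS, mul_one,
    ← mul_sub, add_sub_cancel_right, nonsing_inv_mul _ hX']

/-- The iterates of a map in information form with positive definite `J` tend to a common limit
from all positive definite matrices. -/
theorem HasInfoForm.exists_limit {f : Matrix (Fin n) (Fin n) ℝ → Matrix (Fin n) (Fin n) ℝ}
    (h : HasInfoForm f Q J F) (hJ : J.PosDef) :
    ∃ L : Matrix (Fin n) (Fin n) ℝ, ∀ X, X.PosDef →
      Tendsto (fun k => f^[k] X) atTop (𝓝 L) := by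
  have hD := hJ.inv
  have hJ' := (isUnit_iff_isUnit_det _).1 hJ.isUnit
  have hDT : (J⁻¹)ᵀ = J⁻¹ := by simpa using hD.1.eq
  have hW : (Q + F * J⁻¹ * Fᵀ + J⁻¹).IsHermitian :=
    (h.posQ.1.add (isHermitian_conj F hD.1)).add hD.1
  -- Here `D = J⁻¹` and `B = F J⁻¹`, so `B D⁻¹ Bᵀ = F J⁻¹ Fᵀ` and the slack in the subsolution
  -- inequality is exactly `Q`.
  obtain ⟨Y, hY⟩ := exists_riccati_limit hD (h.unitF.mul hD.isUnit) hW fun v => by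
    rw [transpose_mul, hDT, ← mulVec_mulVec, nonsing_inv_nonsing_inv _ hJ', quad_add, quad_add,
      quad_conj]
    have e : quad J (J⁻¹ *ᵥ (Fᵀ *ᵥ v)) = quad J⁻¹ (Fᵀ *ᵥ v) := by
      rw [quad, mulVec_inv_mulVec hJ.isUnit, dotProduct_comm, quad]
    linarith [quad_nonneg h.posQ v]
  refine ⟨Y - J⁻¹, fun X hX => ?_⟩
  have hP : ∀ k, (f^[k] X).PosDef := by
    intro k
    induction k with
    | zero => exact hX
    | succ k ih => rw [Function.iterate_succ_apply']; exact h.posDef ih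
  have := (hY (fun k => f^[k] X + J⁻¹) (by simpa using hX) fun k => ?_).sub_const J⁻¹
  · simpa using this
  · rw [Function.iterate_succ_apply', h.eq _ (hP k), inv_add_inv_eq hJ (hP k), transpose_mul, hDT]
    noncomm_ring

/-- Pairing `v + Q C v = 0` with `C v` gives two nonnegative terms with sum zero; hence `C v = 0`,
and then `v = 0`. -/
lemma isUnit_one_add_mul (hQ : Q.PosSemidef) (hC : C.PosSemidef) : IsUnit (1 + Q * C) := by
  rw [← mulVec_injective_iff_isUnit]
  refine (injective_iff_map_eq_zero (1 + Q * C).mulVecLin).2 fun v hv => ?_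
  have hv' : v + Q *ᵥ (C *ᵥ v) = 0 := by simpa [add_mulVec] using hv
  have h1 : quad C v + quad Q (C *ᵥ v) = 0 := by
    have := congrArg (fun w => C *ᵥ v ⬝ᵥ w) hv'
    simpa [dotProduct_add, quad, dotProduct_comm] using this
  have h2 := quad_nonneg hC v
  have h3 := quad_nonneg hQ (C *ᵥ v)
  have h4 := (quad_eq_zero_iff hC v).1 (by linarith)
  simpa [h4] using hv'

/-- A measurement after a map in information form. -/
lemma HasInfoForm.measure {f : Matrix (Fin n) (Fin n) ℝ → Matrix (Fin n) (Fin n) ℝ}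
    (h : HasInfoForm f Q J F) (hC : C.PosSemidef) :
    ∃ Q' J' F', HasInfoForm (fun X => ((f X)⁻¹ + C)⁻¹) Q' J' F' ∧
      ∀ v, J' *ᵥ v = 0 → J *ᵥ v = 0 ∧ F' *ᵥ v = F *ᵥ v ∧ C *ᵥ (F *ᵥ v) = 0 := by
  have hU := isUnit_one_add_mul h.posQ hC
  have hUd := (isUnit_iff_isUnit_det _).1 hU
  set L := (1 + Q * C)⁻¹ with hL
  have hLU : IsUnit L := (isUnit_nonsing_inv_iff).2 hU
  have hQT : Qᵀ = Q := by simpa using h.posQ.1.eq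
  have hCT : Cᵀ = C := by simpa using hC.1.eq
  have hT : (1 + Q * C)ᵀ = 1 + C * Q := by simp [hQT, hCT]
  have hr : (1 + Q * C) * L = 1 := mul_nonsing_inv _ hUd
  have hl : L * (1 + Q * C) = 1 := nonsing_inv_mul _ hUd
  have hlT : Lᵀ * (1 + C * Q) = 1 := by rw [← hT, ← transpose_mul, hr, transpose_one]
  have hrT : (1 + C * Q) * Lᵀ = 1 := by rw [← hT, ← transpose_mul, hl, transpose_one]
  have hCL : (C * L).PosSemidef := by
    have : C * L = Lᵀ * (C + C * Q * Cᵀ) * Lᵀᵀ := by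
      have e : C + C * Q * Cᵀ = (1 + C * Q) * C := by rw [hCT]; noncomm_ring
      rw [e, ← mul_assoc, hlT, one_mul, transpose_transpose]
    rw [this]
    exact posSemidef_conj _ (hC.add (posSemidef_conj _ h.posQ))
  have hLQ : (L * Q).PosSemidef := by
    have : L * Q = L * (Q + Q * C * Qᵀ) * Lᵀ := by
      have e : Q + Q * C * Qᵀ = Q * (1 + C * Q) := by rw [hQT]; noncomm_ring
      rw [e, mul_assoc, mul_assoc, hrT, mul_one]
    rw [this]
    exact posSemidef_conj _ (h.posQ.add (posSemidef_conj _ hC))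
  have hFCF : (Fᵀ * (C * L) * F).PosSemidef := by
    simpa using posSemidef_conj Fᵀ hCL
  -- For invertible `Q` and `C`, `L Q = (Q⁻¹ + C)⁻¹` and `C L = (C⁻¹ + Q)⁻¹`; the products with `L`
  -- remain meaningful in the singular case.
  refine ⟨L * Q, J + Fᵀ * (C * L) * F, L * F,
    ⟨hLQ, h.posJ.add hFCF, hLU.mul h.unitF, fun X hX => ?_⟩, fun v hv => ?_⟩
  · have hP := h.posDef hX
    have hPe := h.eq X hX
    have hZ := hX.inv.add_posSemidef h.posJ
    have hV := hX.inv.add_posSemidef (h.posJ.add hFCF)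
    set Z := (X⁻¹ + J)⁻¹ with hZd
    set V := (X⁻¹ + (J + Fᵀ * (C * L) * F))⁻¹ with hVd
    have hZZ : (X⁻¹ + J) * Z = 1 := mul_nonsing_inv _ ((isUnit_iff_isUnit_det _).1 hZ.isUnit)
    have hVV : V * (X⁻¹ + (J + Fᵀ * (C * L) * F)) = 1 :=
      nonsing_inv_mul _ ((isUnit_iff_isUnit_det _).1 hV.isUnit)
    -- Resolvent identity for the inverses `Z` and `V`.
    have hVZ : V * (Fᵀ * (C * L) * F) * Z = Z - V := by
      have e : V * (Fᵀ * (C * L) * F) * Z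
          = V * (X⁻¹ + (J + Fᵀ * (C * L) * F)) * Z - V * ((X⁻¹ + J) * Z) := by noncomm_ring
      rw [e, hVV, hZZ, one_mul, mul_one]
    have hLC : Lᵀ * C = C * L := by
      have := hCL.1.eq
      simpa [hCT] using this
    have hPd := (isUnit_iff_isUnit_det _).1 hP.isUnit
    set P := f X
    have key : (L * Q + L * F * V * (L * F)ᵀ) * (1 + C * P) = P := by
      have e1 : (L * Q + L * F * V * (L * F)ᵀ) * (1 + C * P)
          = L * (1 + Q * C) * Q + (L * (1 + Q * C) - L) * (F * Z * Fᵀ)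
            + L * F * V * Fᵀ * (Lᵀ * (1 + C * Q)) + L * F * V * Fᵀ * (Lᵀ * C) * F * Z * Fᵀ := by
        rw [hPe, transpose_mul]; noncomm_ring
      have e2 : L * F * V * Fᵀ * (C * L) * F * Z * Fᵀ
          = L * F * (V * (Fᵀ * (C * L) * F) * Z) * Fᵀ := by noncomm_ring
      rw [e1, hl, hlT, hLC, e2, hVZ, hPe]
      noncomm_ring
    have hinv : P⁻¹ + C = (1 + C * P) * P⁻¹ := by
      rw [add_mul, one_mul, mul_assoc, mul_nonsing_inv _ hPd, mul_one]
    exact inv_eq_left_inv (by rw [hinv, ← mul_assoc, key, mul_nonsing_inv _ hPd])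
  · have h0 := (quad_eq_zero_iff (h.posJ.add hFCF) v).2 hv
    have h1 := quad_nonneg h.posJ v
    have h2 : quad (Fᵀ * (C * L) * F) v = quad (C * L) (F *ᵥ v) := by
      simpa using quad_conj Fᵀ (C * L) v
    have h3 := quad_nonneg hCL (F *ᵥ v)
    rw [quad_add, h2] at h0
    have h4 := (quad_eq_zero_iff h.posJ v).1 (by linarith)
    have h5 := (quad_eq_zero_iff hCL (F *ᵥ v)).1 (by linarith)
    -- `C L F v = 0`, so the measurement correction vanishes on `F v`: unseen states evolve in open
    -- loop.
    have h6 : F *ᵥ v = L *ᵥ (F *ᵥ v) := by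
      have e : (1 + Q * C) *ᵥ (L *ᵥ (F *ᵥ v)) = F *ᵥ v := by
        rw [mulVec_mulVec, hr, one_mulVec]
      rw [← mulVec_mulVec] at h5
      rw [add_mulVec, one_mulVec, ← mulVec_mulVec, h5, mulVec_zero, add_zero] at e
      exact e.symm
    refine ⟨h4, by rw [← mulVec_mulVec, ← h6], ?_⟩
    rw [h6, mulVec_mulVec, h5]

lemma HasInfoForm.affine {f : Matrix (Fin n) (Fin n) ℝ → Matrix (Fin n) (Fin n) ℝ}
    (h : HasInfoForm f Q J F) {E : Matrix (Fin n) (Fin n) ℝ} (hE : IsUnit E)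
    (hW : W.PosSemidef) :
    HasInfoForm (fun X => E * f X * Eᵀ + W) (E * Q * Eᵀ + W) J (E * F) where
  posQ := (posSemidef_conj E h.posQ).add hW
  posJ := h.posJ
  unitF := hE.mul h.unitF
  eq X hX := by
    rw [h.eq X hX, transpose_mul]
    noncomm_ring

lemma exp_smul_transpose (A : Matrix (Fin n) (Fin n) ℝ) (t : ℝ) :
    NormedSpace.exp (t • Aᵀ) = (NormedSpace.exp (t • A))ᵀ := by
  rw [← Matrix.exp_transpose, transpose_smul]

lemma continuous_exp_smul (A : Matrix (Fin n) (Fin n) ℝ) :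
    Continuous fun s : ℝ => NormedSpace.exp (s • A) :=
  have h : Continuous (NormedSpace.exp : Matrix (Fin n) (Fin n) ℝ → Matrix (Fin n) (Fin n) ℝ) :=
    open scoped Matrix.Norms.Operator in NormedSpace.exp_continuous
  h.comp (by fun_prop)

lemma posSemidef_noiseCov (A : Matrix (Fin n) (Fin n) ℝ) (G : Matrix (Fin n) (Fin m) ℝ) {t : ℝ}
    (ht : 0 ≤ t) : (noiseCov A G t).PosSemidef := by
  set M : ℝ → Matrix (Fin n) (Fin n) ℝ := fun s =>
    NormedSpace.exp (s • A) * (G * Gᵀ) * NormedSpace.exp (s • Aᵀ) with hM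
  have hMP : ∀ s, (M s).PosSemidef := fun s => by
    simp only [hM, exp_smul_transpose]
    exact posSemidef_conj _ (by simpa using posSemidef_self_mul_conjTranspose G)
  have hc : Continuous M := ((continuous_exp_smul A).mul continuous_const).mul
    (continuous_exp_smul Aᵀ)
  have hci : ∀ i j, Continuous fun s => M s i j := fun i j => hc.matrix_elem i j
  refine posSemidef_iff_quad.2 ⟨?_, fun v => ?_⟩
  · ext i j
    simp only [noiseCov, conjTranspose_apply, of_apply, star_trivial]
    exact intervalIntegral.integral_congr fun s _ => by simpa using (hMP s).1.apply i j
  · have : quad (noiseCov A G t) v = ∫ s in (0 : ℝ)..t, quad (M s) v := by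
      simp only [quad, dotProduct, mulVec, Finset.mul_sum]
      rw [intervalIntegral.integral_finsetSum fun i _ =>
        (continuous_finsetSum _ fun j _ => by have := hci i j; fun_prop).intervalIntegrable _ _]
      refine Finset.sum_congr rfl fun i _ => ?_
      rw [intervalIntegral.integral_finsetSum fun j _ => by
        have := hci i j
        exact Continuous.intervalIntegrable (by fun_prop) _ _]
      refine Finset.sum_congr rfl fun j _ => ?_
      rw [intervalIntegral.integral_const_mul, intervalIntegral.integral_mul_const]
      rfl
    rw [this]
    exact intervalIntegral.integral_nonneg ht fun s _ => quad_nonneg (hMP s) v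

lemma predictCov_eq (A : Matrix (Fin n) (Fin n) ℝ) (G : Matrix (Fin n) (Fin m) ℝ) (t : ℝ)
    (S : Matrix (Fin n) (Fin n) ℝ) : predictCov A G t S =
      NormedSpace.exp (t • A) * S * (NormedSpace.exp (t • A))ᵀ + noiseCov A G t := by
  rw [predictCov, exp_smul_transpose]

lemma posSemidef_mul_transpose (c : Matrix (Fin n) (Fin p) ℝ) : (c * cᵀ).PosSemidef := by
  simpa using posSemidef_self_mul_conjTranspose c

lemma posDef_slotUpdate (A : Matrix (Fin n) (Fin n) ℝ) (G : Matrix (Fin n) (Fin m) ℝ) {t : ℝ}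
    (ht : 0 ≤ t) (c : Matrix (Fin n) (Fin p) ℝ) (hX : X.PosSemidef)
    (hu : IsUnit (predictCov A G t X)) : (slotUpdate A G t c X).PosDef := by
  have h1 : (predictCov A G t X).PosSemidef := by
    rw [predictCov_eq]
    exact (posSemidef_conj _ hX).add (posSemidef_noiseCov A G ht)
  exact ((h1.posDef_iff_isUnit.2 hu).inv.add_posSemidef (posSemidef_mul_transpose c)).inv

/-- The update along a list of slots has information form, and a vector in the kernel of its
information matrix is invisible to all sensors of the list. -/
theorem exists_hasInfoForm_foldl (A : Matrix (Fin n) (Fin n) ℝ) (G : Matrix (Fin n) (Fin m) ℝ)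
    {t : ℝ} (ht : 0 ≤ t) (c : Fin N → Matrix (Fin n) (Fin p) ℝ) (l : List (Fin N)) :
    ∃ Q J F, HasInfoForm (fun S => l.foldl (fun S' i => slotUpdate A G t (c i) S') S) Q J F ∧
      ∀ v, J *ᵥ v = 0 → F *ᵥ v = NormedSpace.exp (t • A) ^ l.length *ᵥ v ∧
        ∀ a i b, l = a ++ i :: b →
          (c i)ᵀ *ᵥ (NormedSpace.exp (t • A) ^ (a.length + 1) *ᵥ v) = 0 := by
  -- The last slot acts outermost, so slots are appended on the right. The measurement ends its
  -- slot, whence the exponent `a.length + 1`.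
  induction l using List.reverseRecOn with
  | nil =>
    refine ⟨0, 0, 1, ⟨.zero, .zero, isUnit_one, fun X hX => ?_⟩, fun v _ => ⟨by simp, by simp⟩⟩
    simp [nonsing_inv_nonsing_inv _ ((isUnit_iff_isUnit_det _).1 hX.isUnit)]
  | append_singleton l j ih =>
    obtain ⟨Q, J, F, hf, hv⟩ := ih
    obtain ⟨Q', J', F', hf', hv'⟩ := (hf.affine (Matrix.isUnit_exp (t • A))
      (posSemidef_noiseCov A G ht)).measure (posSemidef_mul_transpose (c j))
    refine ⟨Q', J', F', ?_, fun v h => ?_⟩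
    · simpa [slotUpdate, predictCov_eq] using hf'
    · obtain ⟨h1, h2, h3⟩ := hv' v h
      obtain ⟨h4, h5⟩ := hv v h1
      have h6 : (NormedSpace.exp (t • A) * F) *ᵥ v
          = NormedSpace.exp (t • A) ^ (l.length + 1) *ᵥ v := by
        rw [← mulVec_mulVec, h4, mulVec_mulVec, pow_succ']
      refine ⟨by rw [h2, h6, List.length_append, List.length_singleton], fun a i b hab => ?_⟩
      rcases List.eq_nil_or_concat b with rfl | ⟨b, k, rfl⟩
      · obtain ⟨rfl, h⟩ := List.append_inj' hab rfl
        obtain rfl : j = i := by simpa using h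
        rw [h6] at h3
        have := (conjTranspose_mul_self_mulVec_eq_zero (c j)ᵀ
          (NormedSpace.exp (t • A) ^ (l.length + 1) *ᵥ v)).1 (by simpa using h3)
        exact this
      · rw [List.concat_eq_append, ← List.cons_append, ← List.append_assoc] at hab
        exact h5 a i b (List.append_inj' hab rfl).1

end SampledEstimation

namespace SampledEstimation

/-! ### Observability under periodic sampling -/

open Matrix

variable {n m p N r : ℕ}

lemma exp_mulVec_of_sq_mulVec_eq_zero (A : Matrix (Fin n) (Fin n) ℂ) (v : Fin n → ℂ)
    (h : A *ᵥ (A *ᵥ v) = 0) : NormedSpace.exp A *ᵥ v = v + A *ᵥ v := by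
  have h1 : HasSum (fun k : ℕ => (k.factorial⁻¹ : ℂ) • A ^ k) (NormedSpace.exp A) :=
    open scoped Matrix.Norms.Operator in NormedSpace.exp_series_hasSum_exp' (𝕂 := ℂ) A
  have hc : Continuous fun M : Matrix (Fin n) (Fin n) ℂ => M *ᵥ v := by fun_prop
  let φ : Matrix (Fin n) (Fin n) ℂ →+ (Fin n → ℂ) :=
    { toFun := fun M => M *ᵥ v, map_zero' := zero_mulVec v, map_add' := fun M N => add_mulVec M N v }
  have h2 := h1.map φ hc
  have h3 : HasSum (φ ∘ fun k : ℕ => (k.factorial⁻¹ : ℂ) • A ^ k) _ :=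
    hasSum_sum_of_ne_finset_zero (s := Finset.range 2) fun k hk => by
      obtain ⟨k, rfl⟩ := Nat.exists_eq_add_of_le (not_lt.1 (Finset.mem_range.not.1 hk))
      simp [φ, smul_mulVec, add_comm 2 k, pow_add, sq, ← mulVec_mulVec, h]
  have h4 := h2.unique h3
  simpa [φ, Finset.sum_range_succ] using h4

lemma exp_smul_mulVec (A : Matrix (Fin n) (Fin n) ℂ) (z s : ℂ) (v : Fin n → ℂ)
    (h : (A - z • 1) *ᵥ ((A - z • 1) *ᵥ v) = 0) :
    NormedSpace.exp (s • A) *ᵥ v = Complex.exp (z * s) • (v + s • (A - z • 1) *ᵥ v) := by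
  have e : s • A = algebraMap ℂ (Matrix (Fin n) (Fin n) ℂ) (z * s) + s • (A - z • 1) := by
    rw [Algebra.algebraMap_eq_smul_one, smul_sub, smul_smul, mul_comm z s]; abel
  have hc : Commute (algebraMap ℂ (Matrix (Fin n) (Fin n) ℂ) (z * s)) (s • (A - z • 1)) :=
    Algebra.commutes _ _
  have ha : NormedSpace.exp (algebraMap ℂ (Matrix (Fin n) (Fin n) ℂ) (z * s)) =
      algebraMap ℂ (Matrix (Fin n) (Fin n) ℂ) (NormedSpace.exp (z * s)) :=
    open scoped Matrix.Norms.Operator in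
      (NormedSpace.algebraMap_exp_comm (𝔸 := Matrix (Fin n) (Fin n) ℂ) (z * s)).symm
  rw [e, Matrix.exp_add_of_commute _ _ hc, ha,
    ← mulVec_mulVec, exp_mulVec_of_sq_mulVec_eq_zero _ _ (by
      rw [smul_mulVec, smul_mulVec, mulVec_smul, h, smul_zero, smul_zero]),
    Algebra.algebraMap_eq_smul_one, smul_mulVec, one_mulVec, ← Complex.exp_eq_exp_ℂ, smul_mulVec]

lemma exp_smul_mulVec_of_eigenvector {A : Matrix (Fin n) (Fin n) ℂ} {z : ℂ} {v : Fin n → ℂ}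
    (h : A *ᵥ v = z • v) (s : ℂ) :
    NormedSpace.exp (s • A) *ᵥ v = Complex.exp (z * s) • v := by
  have h0 : (A - z • 1) *ᵥ v = 0 := by simp [sub_mulVec, smul_mulVec, h]
  rw [exp_smul_mulVec A z s v (by rw [h0, mulVec_zero]), h0, smul_zero, add_zero]

lemma mem_spectrum_of_eigenvector {A : Matrix (Fin n) (Fin n) ℂ} {z : ℂ} {v : Fin n → ℂ}
    (hv : v ≠ 0) (h : A *ᵥ v = z • v) : z ∈ spectrum ℂ A := by
  rw [← Matrix.spectrum_toLin']
  exact (Module.End.hasEigenvalue_of_hasEigenvector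
    ⟨Module.End.mem_eigenspace_iff.2 (by simpa using h), hv⟩).mem_spectrum

lemma eq_zero_of_pow_apply_eq_zero {V : Type*} [AddCommGroup V] [Module ℂ V] (h : Module.End ℂ V)
    (h2 : ∀ x, h (h x) = 0 → h x = 0) (k : ℕ) (x : V) (hx : (h ^ k) x = 0) : h x = 0 := by
  induction k with
  | zero => rw [show x = 0 by simpa using hx, map_zero]
  | succ k ih =>
    cases k with
    | zero => simpa using hx
    | succ k =>
      refine ih ?_
      rw [pow_succ', pow_succ'] at hx
      rw [pow_succ']
      exact h2 _ hx

/-- If `z ↦ exp (z τ)` is injective on the spectrum of `A`, then the eigenvectors of `exp (τ A)`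
are eigenvectors of `A`. -/
lemma exists_eigenvalue_of_exp (A : Matrix (Fin n) (Fin n) ℂ) {s : ℂ} (hs : s ≠ 0)
    (hA : ∀ z ∈ spectrum ℂ A, ∀ w ∈ spectrum ℂ A, z ≠ w →
      Complex.exp (z * s) ≠ Complex.exp (w * s))
    {μ : ℂ} {v : Fin n → ℂ} (hv : v ≠ 0) (hμ : NormedSpace.exp (s • A) *ᵥ v = μ • v) :
    ∃ z : ℂ, A *ᵥ v = z • v := by
  set V := Module.End.eigenspace (toLin' (NormedSpace.exp (s • A))) μ
  have hV : ∀ x, x ∈ V ↔ NormedSpace.exp (s • A) *ᵥ x = μ • x := fun x => by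
    rw [Module.End.mem_eigenspace_iff, toLin'_apply]
  have hcomm : Commute A (NormedSpace.exp (s • A)) :=
    ((Commute.refl A).smul_right s).exp_right
  have hinv : ∀ x ∈ V, toLin' A x ∈ V := fun x hx => by
    rw [hV] at hx ⊢
    rw [toLin'_apply, mulVec_mulVec, ← hcomm.eq, ← mulVec_mulVec, hx, mulVec_smul]
  set g := (toLin' A).restrict hinv
  have hg : ∀ (z : ℂ) (x : V), (((g - algebraMap ℂ (Module.End ℂ V) z) x : V) : Fin n → ℂ)
      = (A - z • 1) *ᵥ (x : Fin n → ℂ) := fun z x => by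
    simp [g, sub_mulVec, smul_mulVec, Module.algebraMap_end_apply]
  -- `A` has no Jordan block on `V`. If `y = (A - z) x ≠ 0` and `(A - z) y = 0`, then `y ∈ V` forces
  -- `exp (z s) = μ`, and `exp (s A) x = μ (x + s y)` contradicts `x ∈ V`.
  have hsq : ∀ (z : ℂ) (x : V), (g - algebraMap ℂ _ z) ((g - algebraMap ℂ _ z) x) = 0 →
      (g - algebraMap ℂ _ z) x = 0 := fun z x hx => by
    have h1 : (A - z • 1) *ᵥ ((A - z • 1) *ᵥ (x : Fin n → ℂ)) = 0 := by
      rw [← hg, ← hg, hx]; rfl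
    have h2 := exp_smul_mulVec A z s x h1
    have h3 : (A - z • 1) *ᵥ (A - z • 1) *ᵥ ((A - z • 1) *ᵥ (x : Fin n → ℂ)) = 0 := by
      rw [h1, mulVec_zero]
    have h4 := exp_smul_mulVec A z s _ h3
    rw [h1, smul_zero, add_zero] at h4
    rw [(hV x).1 x.2] at h2
    have h5 := (hV _).1 ((g - algebraMap ℂ _ z) x).2
    rw [hg, h4] at h5
    apply Subtype.ext
    rw [hg, ZeroMemClass.coe_zero]
    by_contra hne
    have h6 : Complex.exp (z * s) = μ := smul_left_injective ℂ hne h5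
    rw [h6, smul_add] at h2
    have h7 : μ • s • (A - z • 1) *ᵥ (x : Fin n → ℂ) = 0 := by simpa using h2
    rcases smul_eq_zero.1 h7 with h | h
    · exact Complex.exp_ne_zero _ (h6.trans h)
    · exact hne ((smul_eq_zero.1 h).resolve_left hs)
  have heig : ∀ (z : ℂ) (x : V), x ≠ 0 → (g - algebraMap ℂ _ z) x = 0 →
      A *ᵥ (x : Fin n → ℂ) = z • (x : Fin n → ℂ) ∧ Complex.exp (z * s) = μ ∧
        z ∈ spectrum ℂ A := fun z x hx h => by
    have hx' : (x : Fin n → ℂ) ≠ 0 := fun h0 => hx (Subtype.ext h0)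
    have h1 : A *ᵥ (x : Fin n → ℂ) = z • (x : Fin n → ℂ) := by
      have := hg z x
      rw [h, sub_mulVec, smul_mulVec, one_mulVec] at this
      exact sub_eq_zero.1 this.symm
    refine ⟨h1, ?_, mem_spectrum_of_eigenvector hx' h1⟩
    have h2 := exp_smul_mulVec_of_eigenvector h1 s
    rw [(hV x).1 x.2] at h2
    exact (smul_left_injective ℂ hx' h2).symm
  let v' : V := ⟨v, (hV v).2 hμ⟩
  have : Nontrivial V := ⟨v', 0, fun h => hv (congrArg Subtype.val h)⟩
  obtain ⟨z, hz⟩ := Module.End.exists_eigenvalue g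
  obtain ⟨x, hx, hx0⟩ := hz.exists_hasEigenvector
  obtain ⟨-, hzμ, hzs⟩ := heig z x hx0 (by
    rw [LinearMap.sub_apply, Module.algebraMap_end_apply, Module.End.mem_eigenspace_iff.1 hx,
      sub_self])
  -- Generalized eigenspaces of `g` are eigenspaces by `hsq`. All eigenvalues of `g` have the same
  -- exponential `μ`, so non-aliasing leaves only `z`.
  have htop : (⊤ : Submodule ℂ V) ≤ Module.End.eigenspace g z := by
    rw [← Module.End.iSup_maxGenEigenspace_eq_top g]
    refine iSup_le fun w y hy => ?_
    obtain ⟨k, hk⟩ := Module.End.mem_maxGenEigenspace _ _ _ |>.1 hy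
    have hy0 := eq_zero_of_pow_apply_eq_zero (g - algebraMap ℂ _ w) (hsq w) k y (by
      simpa [Algebra.algebraMap_eq_smul_one] using hk)
    rcases eq_or_ne y 0 with rfl | hne
    · exact zero_mem _
    · obtain ⟨-, hwμ, hws⟩ := heig w y hne hy0
      have : w = z := by
        by_contra hwz
        exact hA w hws z hzs hwz (hwμ.trans hzμ.symm)
      subst this
      rw [Module.End.mem_eigenspace_iff]
      simpa [sub_eq_zero, Module.algebraMap_end_apply] using hy0
  have h := Module.End.mem_eigenspace_iff.1 (htop (Submodule.mem_top (x := v')))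
  exact ⟨z, by simpa [g, v'] using congrArg Subtype.val h⟩

lemma map_exp_smul (A : Matrix (Fin n) (Fin n) ℝ) (t : ℝ) :
    (NormedSpace.exp (t • A)).map (algebraMap ℝ ℂ) =
      NormedSpace.exp ((t : ℂ) • A.map (algebraMap ℝ ℂ)) := by
  have hc : Continuous ((algebraMap ℝ ℂ).mapMatrix (m := Fin n)) :=
    Continuous.matrix_map continuous_id Complex.continuous_ofReal
  have h : (NormedSpace.exp (t • A)).map (algebraMap ℝ ℂ) =
      NormedSpace.exp ((algebraMap ℝ ℂ).mapMatrix (t • A)) :=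
    open scoped Matrix.Norms.Operator in
      NormedSpace.map_exp (algebraMap ℝ ℂ).mapMatrix hc (t • A)
  refine h.trans (congrArg NormedSpace.exp ?_)
  ext i j
  simp

lemma mulVec_injective_of_isObservable {κ : Type*} [Fintype κ] {A : Matrix (Fin n) (Fin n) ℝ}
    {c : Matrix (Fin n) κ ℝ} (h : IsObservable A c) (v : Fin n → ℝ)
    (hv : observabilityMatrix A c *ᵥ v = 0) : v = 0 := by
  have e := LinearMap.finrank_range_add_finrank_ker (observabilityMatrix A c).mulVecLin
  have h' : Module.finrank ℝ (LinearMap.range (observabilityMatrix A c).mulVecLin) = n := h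
  rw [h', Module.finrank_fin_fun] at e
  have h0 : LinearMap.ker (observabilityMatrix A c).mulVecLin = ⊥ :=
    Submodule.finrank_eq_zero.1 (by omega)
  have : v ∈ LinearMap.ker (observabilityMatrix A c).mulVecLin := by simpa using hv
  rwa [h0, Submodule.mem_bot] at this

/-- Under observability no complex eigenvector is invisible to all sensors. -/
lemma eigenvector_eq_zero_of_isObservable {A : Matrix (Fin n) (Fin n) ℝ}
    {c : Fin N → Matrix (Fin n) (Fin p) ℝ} (h : IsObservable A (concatSensors c))
    {x : Fin n → ℂ} {z : ℂ} (hx : A.map (algebraMap ℝ ℂ) *ᵥ x = z • x)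
    (hc : ∀ i, (c i).transpose.map (algebraMap ℝ ℂ) *ᵥ x = 0) : x = 0 := by
  have hpow : ∀ k : ℕ, A.map (algebraMap ℝ ℂ) ^ k *ᵥ x = z ^ k • x := by
    intro k
    induction k with
    | zero => simp
    | succ k ih => rw [pow_succ', ← mulVec_mulVec, ih, mulVec_smul, hx, smul_smul, pow_succ]
  have hO : ∀ kj, ∑ a, (observabilityMatrix A (concatSensors c) kj a : ℂ) * x a = 0 := by
    rintro ⟨k, i, j⟩
    have h1 : ((c i).transpose * A ^ (k : ℕ)).map (algebraMap ℝ ℂ) *ᵥ x = 0 := by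
      rw [Matrix.map_mul, Matrix.map_pow, ← mulVec_mulVec, hpow, mulVec_smul, hc, smul_zero]
    have h2 := congrFun h1 j
    simpa [mulVec, dotProduct, observabilityMatrix, concatSensors, Matrix.mul_apply] using h2
  have hre : (fun a => (x a).re) = 0 := mulVec_injective_of_isObservable h _ <| by
    ext kj
    simpa [mulVec, dotProduct] using congrArg Complex.re (hO kj)
  have him : (fun a => (x a).im) = 0 := mulVec_injective_of_isObservable h _ <| by
    ext kj
    simpa [mulVec, dotProduct] using congrArg Complex.im (hO kj)
  ext a
  exact Complex.ext (congrFun hre a) (congrFun him a)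

/-- Cayley–Hamilton reduces `M ^ k` to a polynomial of degree at most `n`. Using `n + 1` powers
rather than `n` also covers `n = 0` uniformly. -/
lemma mulVec_pow_eq_zero {κ : Type*} (M : Matrix (Fin n) (Fin n) ℝ)
    (C : Matrix κ (Fin n) ℝ) (v : Fin n → ℝ) (h : ∀ k < n + 1, C *ᵥ (M ^ k *ᵥ v) = 0) (k : ℕ) :
    C *ᵥ (M ^ k *ᵥ v) = 0 := by
  have hd : (Polynomial.X ^ k %ₘ M.charpoly).natDegree < n + 1 := by
    have := Polynomial.natDegree_modByMonic_le (Polynomial.X ^ k) M.charpoly_monic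
    rw [charpoly_natDegree_eq_dim, Fintype.card_fin] at this
    omega
  rw [Matrix.pow_eq_aeval_mod_charpoly, Polynomial.aeval_eq_sum_range' hd, sum_mulVec, mulVec_sum]
  refine Finset.sum_eq_zero fun j hj => ?_
  rw [smul_mulVec, mulVec_smul, h j (Finset.mem_range.1 hj), smul_zero]

/-- Sampled observability: a state that is invisible to each sensor at one instant of every period
vanishes. -/
theorem eq_zero_of_sampled {A : Matrix (Fin n) (Fin n) ℝ}
    {c : Fin N → Matrix (Fin n) (Fin p) ℝ} (hobs : IsObservable A (concatSensors c))
    {τ : ℝ} (hτ : τ ∈ nonAliasingPeriods A) (t : ℝ) (q : Fin N → ℕ) (v : Fin n → ℝ)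
    (h : ∀ i k, ((c i).transpose * NormedSpace.exp (t • A) ^ q i) *ᵥ
      (NormedSpace.exp (τ • A) ^ k *ᵥ v) = 0) : v = 0 := by
  set ι := algebraMap ℝ ℂ
  set M := (NormedSpace.exp (τ • A)).map ι
  set H : Fin N → Matrix (Fin p) (Fin n) ℂ := fun i =>
    ((c i).transpose * NormedSpace.exp (t • A) ^ q i).map ι
  let U : Submodule ℂ (Fin n → ℂ) := ⨅ i, ⨅ k : ℕ, LinearMap.ker (H i * M ^ k).mulVecLin
  have hU : ∀ x, x ∈ U ↔ ∀ i k, (H i * M ^ k) *ᵥ x = 0 := fun x => by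
    simp [U, Submodule.mem_iInf]
  by_contra hv
  have hvU : (ι ∘ v) ∈ U := (hU _).2 fun i k => by
    have h2 : (H i * M ^ k) = (((c i).transpose * NormedSpace.exp (t • A) ^ q i) *
      NormedSpace.exp (τ • A) ^ k).map ι := by rw [Matrix.map_mul, Matrix.map_pow]
    rw [h2]
    ext a
    rw [← RingHom.map_mulVec, ← mulVec_mulVec, h i k]
    simp
  have hinv : ∀ x ∈ U, toLin' M x ∈ U := fun x hx => by
    rw [hU] at hx ⊢
    intro i k
    rw [toLin'_apply, mulVec_mulVec, Matrix.mul_assoc, ← pow_succ]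
    exact hx i (k + 1)
  have : Nontrivial U := ⟨⟨ι ∘ v, hvU⟩, 0, fun h0 => hv <| by
    have h1 := congrArg Subtype.val h0
    ext a
    simpa [ι] using congrFun h1 a⟩
  obtain ⟨μ, hμ⟩ := Module.End.exists_eigenvalue ((toLin' M).restrict hinv)
  obtain ⟨x, hx, hx0⟩ := hμ.exists_hasEigenvector
  have hx1 : M *ᵥ (x : Fin n → ℂ) = μ • (x : Fin n → ℂ) := by
    simpa using congrArg Subtype.val (Module.End.mem_eigenspace_iff.1 hx)
  have hx0' : (x : Fin n → ℂ) ≠ 0 := fun h0 => hx0 (Subtype.ext h0)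
  obtain ⟨z, hz⟩ := exists_eigenvalue_of_exp (A.map ι) (Complex.ofReal_ne_zero.2 hτ.1.ne') hτ.2 hx0'
    (by rw [← map_exp_smul]; exact hx1)
  refine hx0' (eigenvector_eq_zero_of_isObservable hobs hz fun i => ?_)
  -- The sensors are read at different instants, but on `x` the flow between them is a nonzero
  -- scalar, so every `c i` annihilates the same `x`.
  have hE : ∀ k : ℕ, (NormedSpace.exp (t • A)).map ι ^ k *ᵥ (x : Fin n → ℂ)
      = Complex.exp (z * t) ^ k • (x : Fin n → ℂ) := by
    intro k
    induction k with
    | zero => simp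
    | succ k ih =>
      rw [pow_succ', ← mulVec_mulVec, ih, mulVec_smul, map_exp_smul,
        exp_smul_mulVec_of_eigenvector hz, smul_smul, pow_succ]
  have h1 := (hU x).1 x.2 i 0
  rw [pow_zero, Matrix.mul_one] at h1
  simp only [H] at h1
  rw [Matrix.map_mul, Matrix.map_pow, ← mulVec_mulVec, hE, mulVec_smul] at h1
  exact (smul_eq_zero.1 h1).resolve_left (pow_ne_zero _ (Complex.exp_ne_zero _))

/-! ### From several periods to the full sequence -/

lemma iterate_foldl {α β : Type*} (f : β → α → β) (l : List α) (k : ℕ) (b : β) :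
    (fun s => l.foldl f s)^[k] b = (List.replicate k l).flatten.foldl f b := by
  induction k generalizing b with
  | zero => rfl
  | succ k ih =>
    rw [Function.iterate_succ_apply, ih, List.replicate_succ, List.flatten_cons, List.foldl_append]

lemma flatten_replicate_eq {α : Type*} (a b : List α) (i : α) {k K : ℕ} (hk : k < K) :
    (List.replicate K (a ++ i :: b)).flatten = ((List.replicate k (a ++ i :: b)).flatten ++ a) ++
      i :: (b ++ (List.replicate (K - k - 1) (a ++ i :: b)).flatten) := by
  obtain ⟨d, rfl⟩ := Nat.exists_eq_add_of_lt hk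
  rw [show k + d + 1 = k + (1 + d) by ring, List.replicate_add, List.replicate_add]
  simp

/-- Over sufficiently many periods the information matrix is positive definite. -/
theorem exists_hasInfoForm_posDef (A : Matrix (Fin n) (Fin n) ℝ) (G : Matrix (Fin n) (Fin m) ℝ)
    (c : Fin N → Matrix (Fin n) (Fin p) ℝ) (hobs : IsObservable A (concatSensors c))
    (R : Fin r → Fin N) (hR : Function.Surjective R) (hr : r ≠ 0)
    {τ : ℝ} (hτ : τ ∈ nonAliasingPeriods A) :
    ∃ Q J F, HasInfoForm (periodUpdate A G c τ R)^[n + 1] Q J F ∧ J.PosDef := by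
  obtain ⟨Q, J, F, hf, hJ⟩ := exists_hasInfoForm_foldl A G (t := τ / r)
    (div_nonneg hτ.1.le r.cast_nonneg) c (List.replicate (n + 1) (List.ofFn R)).flatten
  refine ⟨Q, J, F, ?_, posDef_iff_quad.2 ⟨hf.posJ.1, fun v hv => ?_⟩⟩
  · convert hf using 1
    ext1 S
    exact iterate_foldl _ _ _ _
  refine lt_of_le_of_ne (quad_nonneg hf.posJ v) fun h0 => hv ?_
  have h1 := (hJ v ((quad_eq_zero_iff hf.posJ v).1 h0.symm)).2
  have hmem : ∀ i, ∃ a b, List.ofFn R = a ++ i :: b := fun i => by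
    obtain ⟨l, hl⟩ := hR i
    exact List.append_of_mem (List.mem_ofFn.2 ⟨l, hl⟩)
  choose a b hab using hmem
  have hE : NormedSpace.exp ((τ / r) • A) ^ r = NormedSpace.exp (τ • A) := by
    rw [← Matrix.exp_nsmul, ← Nat.cast_smul_eq_nsmul ℝ, smul_smul,
      mul_div_cancel₀ _ (Nat.cast_ne_zero.2 hr)]
  refine eq_zero_of_sampled hobs hτ (τ / r) (fun i => (a i).length + 1) v fun i k => ?_
  refine mulVec_pow_eq_zero _ _ v (fun k hk => ?_) k
  have h2 := h1 _ i _ (by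
    have := flatten_replicate_eq (a i) (b i) i hk
    rwa [← hab i] at this)
  rw [← h2, ← hE, ← mulVec_mulVec, mulVec_mulVec v, ← pow_mul, ← pow_add]
  congr 3
  simp
  ring

lemma tendsto_of_tendsto_mul_add {α : Type*} {l : Filter α} (u : ℕ → α) {K : ℕ} (hK : K ≠ 0)
    (h : ∀ j < K, Tendsto (fun q => u (K * q + j)) atTop l) : Tendsto u atTop l := by
  intro s hs
  have h1 : ∀ᶠ q in atTop, ∀ j ∈ Finset.range K, u (K * q + j) ∈ s :=
    (Filter.eventually_all_finset _).2 fun j hj => h j (Finset.mem_range.1 hj) hs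
  rw [mem_map]
  filter_upwards [(Nat.tendsto_div_const_atTop hK).eventually h1] with k hk
  have : u (K * (k / K) + k % K) ∈ s := hk (k % K) (Finset.mem_range.2 (Nat.mod_lt _ (Nat.pos_of_ne_zero hK)))
  rwa [Nat.div_add_mod] at this

/-- The first slot already makes the covariance positive definite, and information forms preserve
this; so singular initial data enter the theory after one period. -/
lemma posDef_periodUpdate (A : Matrix (Fin n) (Fin n) ℝ) (G : Matrix (Fin n) (Fin m) ℝ)
    (c : Fin N → Matrix (Fin n) (Fin p) ℝ) {τ : ℝ} (hτ : 0 ≤ τ) (hr : r ≠ 0) (R : Fin r → Fin N)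
    {S : Matrix (Fin n) (Fin n) ℝ} (hS : S.PosSemidef)
    (hu : IsUnit (predictCov A G (τ / r) S)) : (periodUpdate A G c τ R S).PosDef := by
  have ht : 0 ≤ τ / r := div_nonneg hτ r.cast_nonneg
  obtain ⟨i, l, hl⟩ := List.exists_cons_of_ne_nil (l := List.ofFn R) (by simpa using hr)
  obtain ⟨Q, J, F, hf, -⟩ := exists_hasInfoForm_foldl A G ht c l
  rw [periodUpdate, hl, List.foldl_cons]
  exact hf.posDef (posDef_slotUpdate A G ht (c i) hS hu)

end SampledEstimation

theorem mainTheorem5 {n m p N r : ℕ}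
    (A : Matrix (Fin n) (Fin n) ℝ) (G : Matrix (Fin n) (Fin m) ℝ)
    (c : Fin N → Matrix (Fin n) (Fin p) ℝ)
    (hobs : SampledEstimation.IsObservable A (SampledEstimation.concatSensors c))
    (rmin : ℕ) (hrmin : 0 < rmin)
    (R : Fin r → Fin N) (hR : R ∈ SampledEstimation.strategySet N r rmin)
    (τ : ℝ) (hτ : τ ∈ SampledEstimation.nonAliasingPeriods A) :
    ∃ Slim : Matrix (Fin n) (Fin n) ℝ, ∀ S₀ : Matrix (Fin n) (Fin n) ℝ,
      S₀.PosSemidef → IsUnit (SampledEstimation.predictCov A G (τ / r) S₀) →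
        Tendsto (fun k : ℕ => (SampledEstimation.periodUpdate A G c τ R)^[k] S₀) atTop
          (𝓝 Slim) := by
  have hsurj : Function.Surjective R := fun i => by
    obtain ⟨l, hl⟩ := Finset.card_pos.1 (hrmin.trans_le (hR i))
    exact ⟨l, (Finset.mem_filter.1 hl).2⟩
  -- Without slots there are no sensors, so the observability matrix has no rows and `n = 0`.
  rcases eq_or_ne r 0 with rfl | hr
  · have : IsEmpty (Fin N) := ⟨fun i => (hsurj i).elim fun l _ => l.elim0⟩
    have hn : n = 0 := by
      have h := (SampledEstimation.observabilityMatrix A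
        (SampledEstimation.concatSensors c)).rank_le_card_height
      rw [show Matrix.rank _ = n from hobs] at h
      simpa using h
    subst hn
    exact ⟨0, fun S₀ _ _ => tendsto_const_nhds.congr fun k => Subsingleton.elim _ _⟩
  obtain ⟨Q, J, F, hf, hJ⟩ :=
    SampledEstimation.exists_hasInfoForm_posDef A G c hobs R hsurj hr hτ
  obtain ⟨L, hL⟩ := hf.exists_limit hJ
  refine ⟨L, fun S₀ hS hu => ?_⟩
  rw [← tendsto_add_atTop_iff_nat 1]
  have hpd : ∀ k, ((SampledEstimation.periodUpdate A G c τ R)^[k + 1] S₀).PosDef := by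
    intro k
    induction k with
    | zero => exact SampledEstimation.posDef_periodUpdate A G c hτ.1.le hr R hS hu
    | succ k ih =>
      obtain ⟨Q, J, F, hf, -⟩ := SampledEstimation.exists_hasInfoForm_foldl A G
        (div_nonneg hτ.1.le r.cast_nonneg : 0 ≤ τ / r) c (List.ofFn R)
      rw [Function.iterate_succ_apply']
      exact hf.posDef ih
  -- Each residue class modulo `n + 1` is an orbit of the `(n + 1)`-period map from a positive
  -- definite start, and all these orbits have the same limit `L`.
  refine SampledEstimation.tendsto_of_tendsto_mul_add _ n.succ_ne_zero fun j _ =>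
    (hL _ (hpd j)).congr fun q => ?_
  rw [← Function.iterate_mul, ← Function.iterate_add_apply, add_assoc]
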